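/- Let $n\ge 1$ be an integer, $u>0$ a real number, and $$\Delta^{n,u}=\{\theta\in\mathbb{R}^n : \theta_1+\cdots+\theta_n=u,\ \theta_i\ge 0 \text{ for } 1\le i\le n\}.$$ For $\theta,\theta'\in\Delta^{n,u}$ write $\theta\le_{\mathrm{hr}}\theta'$ (hazard rate order) if $$\Big(\sum_{k=i}^n\theta_k\Big)\Big(\sum_{k=j}^n\theta'_k\Big)\ \ge\ \Big(\sum_{k=j}^n\theta_k\Big)\Big(\sum_{k=i}^n\theta'_k\Big)\qquad\text{for all } 1\le i\le j\le n.$$ Let $\Theta$ and $\Theta'$ be independent random vectors, each uniformly distributed on $\Delta^{n,u}$ (with respect to $(n-1)$-dimensional volume). Then $$P(\Theta\le_{\mathrm{hr}}\Theta')=\frac{1}{2^{n-1}}.$$ Moreover, given real numbers $x_1<\cdots<x_n$, let $P_\theta=\sum_{i=1}^n\theta_i\,\delta_{x_i}$ be the measure on $\mathbb{R}$ that gives mass $\theta_i$ to $x_i$ (for $u=1$, the probability distribution induced by the element $\theta$ of the probability simplex), and for finite measures $\mu,\nu$ on $\mathbb{R}$ write $\mu\le_{\mathrm{hr}}\nu$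 if $\mu((s,\infty))\,\nu((t,\infty))\ge\mu((t,\infty))\,\nu((s,\infty))$ for all real $s\le t$. Then also $$P(P_\Theta\le_{\mathrm{hr}}P_{\Theta'})=\frac{1}{2^{n-1}}.$$ -/

import Mathlib

open MeasureTheory ProbabilityTheory
open scoped ENNReal MeasureTheory

/-- The scaled simplex `Δ^{n,u}`: vectors in `ℝⁿ` with nonnegative coordinates summing to `u`. -/
def scaledSimplex (n : ℕ) (u : ℝ) : Set (EuclideanSpace ℝ (Fin n)) :=
  {θ | (∀ i, 0 ≤ θ i) ∧ ∑ i, θ i = u}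

/-- The tail sum `θ_i + ⋯ + θ_n`. -/
noncomputable def tailSum {n : ℕ} (θ : EuclideanSpace ℝ (Fin n)) (i : Fin n) : ℝ :=
  ∑ k ∈ Finset.Ici i, θ k

/-- The hazard rate order on vectors: `θ ≤_hr θ'`. -/
def HazardRateLE {n : ℕ} (θ θ' : EuclideanSpace ℝ (Fin n)) : Prop :=
  ∀ i j : Fin n, i ≤ j → tailSum θ i * tailSum θ' j ≥ tailSum θ j * tailSum θ' i

/-- The distribution `P_θ` on the real line that gives mass `θ_i` to the point `x_i`. -/
noncomputable def inducedDistribution {n : ℕ} (x : Fin n → ℝ) (θ : EuclideanSpace ℝ (Fin n)) :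
    Measure ℝ :=
  ∑ i, ENNReal.ofReal (θ i) • Measure.dirac (x i)

/-- The hazard rate order on (finite) measures on the real line, in terms of the survival
functions `t ↦ μ (t, ∞)`: `μ ≤_hr ν` if `μ (s, ∞) ν (t, ∞) ≥ μ (t, ∞) ν (s, ∞)` for `s ≤ t`.
The condition does not change when `μ` or `ν` is multiplied by a positive constant. -/
def MeasureHazardRateLE (μ ν : Measure ℝ) : Prop :=
  ∀ s t : ℝ, s ≤ t →
    μ.real (Set.Ioi s) * ν.real (Set.Ioi t) ≥ μ.real (Set.Ioi t) * ν.real (Set.Ioi s)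

/-- `Θ` is uniformly distributed on `Δ^{n,u}` with respect to the `(n-1)`-dimensional volume. -/
def IsUniformOnSimplex {Ω : Type*} [MeasurableSpace Ω] (P : Measure Ω) {n : ℕ} (u : ℝ)
    (Θ : Ω → EuclideanSpace ℝ (Fin n)) : Prop :=
  pdf.IsUniform Θ (scaledSimplex n u) P
    (Measure.euclideanHausdorffMeasure (n - 1) : Measure (EuclideanSpace ℝ (Fin n)))

/-- Vectors `t` such that consecutive entries of `(a, t₀, t₁, …)` are related by `R`. -/
def chainSet {X : Type*} (R : X → X → Prop) (m : ℕ) (a : X) : Set (Fin m → X) :=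
  {t | ∀ i : Fin m, R ((Fin.cons a t : Fin (m + 1) → X) i.castSucc) (t i)}

theorem mem_chainSet_succ {X : Type*} {R : X → X → Prop} {m : ℕ} {a : X} {t : Fin (m + 1) → X} :
    t ∈ chainSet R (m + 1) a ↔ R a (t 0) ∧ Fin.tail t ∈ chainSet R m (t 0) := by
  simp only [chainSet, Set.mem_ofPred_eq, Fin.forall_fin_succ (n := m)]
  refine and_congr (by simp) (forall_congr' fun i ↦ ?_)
  rw [Fin.castSucc_succ, Fin.cons_succ]
  conv_lhs => rw [← Fin.cons_self_tail t]
  rfl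

theorem measurableSet_chainSet {X : Type*} [MeasurableSpace X] {R : X → X → Prop}
    (hR : MeasurableSet {p : X × X | R p.1 p.2}) (m : ℕ) :
    MeasurableSet {p : X × (Fin m → X) | p.2 ∈ chainSet R m p.1} := by
  have hset : {p : X × (Fin m → X) | p.2 ∈ chainSet R m p.1} =
      ⋂ i : Fin m, {p | R ((Fin.cons p.1 p.2 : Fin (m + 1) → X) i.castSucc) (p.2 i)} := by
    ext p
    simp [chainSet]
  rw [hset]
  refine MeasurableSet.iInter fun i ↦ ?_
  have h : Measurable fun p : X × (Fin m → X) ↦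
      ((Fin.cons p.1 p.2 : Fin (m + 1) → X) i.castSucc, p.2 i) := by
    refine Measurable.prodMk ?_ (by fun_prop)
    generalize i.castSucc = j
    induction j using Fin.cases with
    | zero => simpa using measurable_fst
    | succ j => simp only [Fin.cons_succ]; fun_prop
  exact h hR

theorem volume_chainSet_succ {X : Type*} [MeasureSpace X] [SigmaFinite (volume : Measure X)]
    {R : X → X → Prop} (hR : MeasurableSet {p : X × X | R p.1 p.2}) (m : ℕ) (a : X) :
    volume (chainSet R (m + 1) a) = ∫⁻ s in {s | R a s}, volume (chainSet R m s) := by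
  have hRa : MeasurableSet {s | R a s} := (measurable_const.prodMk measurable_id :
    Measurable fun s : X ↦ (a, s)) hR
  have hpre : chainSet R (m + 1) a = MeasurableEquiv.piFinSuccAbove (fun _ ↦ X) 0 ⁻¹'
      {p : X × (Fin m → X) | R a p.1 ∧ p.2 ∈ chainSet R m p.1} := by
    ext t
    rw [mem_chainSet_succ]
    rfl
  have hmeas : MeasurableSet {p : X × (Fin m → X) | R a p.1 ∧ p.2 ∈ chainSet R m p.1} :=
    (measurable_fst hRa).inter (measurableSet_chainSet hR m)
  rw [hpre, (volume_preserving_piFinSuccAbove (fun _ : Fin (m + 1) ↦ X) 0).measure_preimage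
    hmeas.nullMeasurableSet, Measure.volume_eq_prod, Measure.prod_apply hmeas,
    ← lintegral_indicator hRa]
  refine lintegral_congr fun s ↦ ?_
  by_cases hs : R a s
  · rw [Set.indicator_of_mem (by exact hs)]
    congr 1
    ext t
    simp [hs]
  · rw [Set.indicator_of_notMem (by exact hs)]
    simp [hs]

theorem lintegral_Icc_const_mul_pow (m : ℕ) {a c : ℝ} (ha : 0 ≤ a) (hc : 0 ≤ c) :
    ∫⁻ x in Set.Icc 0 a, ENNReal.ofReal (c * x ^ m) =
      ENNReal.ofReal (c * (a ^ (m + 1) / (m + 1))) := by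
  rw [← ofReal_integral_eq_lintegral_ofReal]
  · rw [integral_Icc_eq_integral_Ioc, ← intervalIntegral.integral_of_le ha,
      intervalIntegral.integral_const_mul, integral_pow]
    simp
  · exact (Continuous.continuousOn (by fun_prop)).integrableOn_Icc
  · filter_upwards [ae_restrict_mem measurableSet_Icc] with x hx
    have := hx.1
    positivity

/-- The relation whose chains starting at `u` are the tail sums of the elements of `Δ^{n,u}`. -/
def TailStep (a s : ℝ) : Prop := 0 ≤ s ∧ s ≤ a

theorem measurableSet_tailStep : MeasurableSet {p : ℝ × ℝ | TailStep p.1 p.2} :=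
  (measurableSet_le measurable_const measurable_snd).inter
    (measurableSet_le measurable_snd measurable_fst)

/-- The relation between consecutive pairs of tail sums of hazard rate ordered vectors. -/
def HazardStep (p q : ℝ × ℝ) : Prop :=
  TailStep p.1 q.1 ∧ TailStep p.2 q.2 ∧ q.1 * p.2 ≤ p.1 * q.2

theorem measurableSet_hazardStep :
    MeasurableSet {z : (ℝ × ℝ) × (ℝ × ℝ) | HazardStep z.1 z.2} :=
  ((by fun_prop : Measurable fun z : (ℝ × ℝ) × (ℝ × ℝ) ↦ (z.1.1, z.2.1))
      measurableSet_tailStep).inter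
    (((by fun_prop : Measurable fun z : (ℝ × ℝ) × (ℝ × ℝ) ↦ (z.1.2, z.2.2))
      measurableSet_tailStep).inter (measurableSet_le (f := fun z : (ℝ × ℝ) × (ℝ × ℝ) ↦ z.2.1 * z.1.2)
        (g := fun z : (ℝ × ℝ) × (ℝ × ℝ) ↦ z.1.1 * z.2.2) (by fun_prop) (by fun_prop)))

theorem volume_chainSet_tailStep (m : ℕ) {a : ℝ} (ha : 0 ≤ a) :
    volume (chainSet TailStep m a) = ENNReal.ofReal (a ^ m / m.factorial) := by
  induction m generalizing a with
  | zero =>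
    have : chainSet TailStep 0 a = Set.univ := by ext; simp [chainSet]
    simp [this, volume_pi]
  | succ m ih =>
    rw [volume_chainSet_succ measurableSet_tailStep]
    change ∫⁻ s in Set.Icc 0 a, _ = _
    rw [setLIntegral_congr_fun (g := fun s ↦ ENNReal.ofReal ((m.factorial : ℝ)⁻¹ * s ^ m))
      measurableSet_Icc, lintegral_Icc_const_mul_pow m ha (by positivity)]
    · congr 1
      rw [Nat.factorial_succ]
      push_cast
      field_simp
    · intro s hs
      simp only [ih hs.1]
      congr 1
      ring

theorem lintegral_hazardStep (m : ℕ) {a b c : ℝ} (ha : 0 ≤ a) (hb : 0 ≤ b) (hc : 0 ≤ c) :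
    ∫⁻ q in {q | HazardStep (a, b) q}, ENNReal.ofReal (c * (q.1 ^ m * q.2 ^ m)) =
      ENNReal.ofReal (c * (a ^ (m + 1) * b ^ (m + 1)) / (2 * (m + 1) ^ 2)) := by
  have hS : MeasurableSet {q | HazardStep (a, b) q} := (measurable_const.prodMk measurable_id :
    Measurable fun q : ℝ × ℝ ↦ ((a, b), q)) measurableSet_hazardStep
  rw [← lintegral_indicator hS, Measure.volume_eq_prod, lintegral_prod_symm]
  · rcases hb.eq_or_lt with rfl | hb
    · have : ∀ᵐ y : ℝ, y ≠ 0 := by simp [ae_iff]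
      rw [lintegral_congr_ae (g := fun _ ↦ 0)]
      · simp
      · filter_upwards [this] with y hy
        refine (lintegral_congr fun x ↦ ?_).trans lintegral_zero
        refine Set.indicator_of_notMem (fun h ↦ hy ?_) _
        exact le_antisymm h.2.1.2 h.2.1.1
    rw [lintegral_congr (g := (Set.Icc 0 b).indicator fun y ↦
      ENNReal.ofReal (c * (a / b) ^ (m + 1) / (m + 1) * y ^ (2 * m + 1)))]
    · rw [lintegral_indicator measurableSet_Icc,
        lintegral_Icc_const_mul_pow _ hb.le (by positivity)]
      congr 1
      push_cast
      rw [div_pow]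
      field_simp
      ring
    · intro y
      by_cases hy : y ∈ Set.Icc 0 b
      · have hy0 := hy.1
        rw [Set.indicator_of_mem hy, show c * (a / b) ^ (m + 1) / (m + 1) * y ^ (2 * m + 1) =
            (c * y ^ m) * ((a / b * y) ^ (m + 1) / (m + 1)) by rw [mul_pow]; ring,
          ← lintegral_Icc_const_mul_pow m (by positivity) (by positivity),
          ← lintegral_indicator measurableSet_Icc]
        refine lintegral_congr fun x ↦ ?_
        have hiff : (x, y) ∈ {q | HazardStep (a, b) q} ↔ x ∈ Set.Icc 0 (a / b * y) := by
          have h1 : x ≤ a / b * y ↔ x * b ≤ a * y := by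
            rw [div_mul_eq_mul_div, le_div_iff₀ hb]
          have h2 : x * b ≤ a * y → x ≤ a := fun h ↦
            le_of_mul_le_mul_right (h.trans (mul_le_mul_of_nonneg_left hy.2 ha)) hb
          simp only [HazardStep, TailStep, Set.mem_ofPred_eq, Set.mem_Icc, h1]
          exact ⟨fun h ↦ ⟨h.1.1, h.2.2⟩, fun h ↦ ⟨⟨h.1, h2 h.2⟩, hy, h.2⟩⟩
        by_cases hx : x ∈ Set.Icc 0 (a / b * y)
        · rw [Set.indicator_of_mem hx, Set.indicator_of_mem (hiff.2 hx)]
          congr 1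
          ring
        · rw [Set.indicator_of_notMem hx, Set.indicator_of_notMem (mt hiff.1 hx)]
      · rw [Set.indicator_of_notMem hy]
        refine (lintegral_congr fun x ↦ ?_).trans lintegral_zero
        exact Set.indicator_of_notMem (fun h ↦ hy h.2.1) _
  · exact (Measurable.indicator (by fun_prop) hS).aemeasurable

theorem volume_chainSet_hazardStep (m : ℕ) {a b : ℝ} (ha : 0 ≤ a) (hb : 0 ≤ b) :
    volume (chainSet HazardStep m (a, b)) =
      ENNReal.ofReal ((a ^ m / m.factorial) * (b ^ m / m.factorial) / 2 ^ m) := by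
  induction m generalizing a b with
  | zero =>
    have : chainSet HazardStep 0 (a, b) = Set.univ := by ext; simp [chainSet]
    simp [this, volume_pi]
  | succ m ih =>
    have hS : MeasurableSet {q | HazardStep (a, b) q} := (measurable_const.prodMk measurable_id :
      Measurable fun q : ℝ × ℝ ↦ ((a, b), q)) measurableSet_hazardStep
    rw [volume_chainSet_succ measurableSet_hazardStep, setLIntegral_congr_fun
      (g := fun q ↦ ENNReal.ofReal (((m.factorial : ℝ) ^ 2 * 2 ^ m)⁻¹ * (q.1 ^ m * q.2 ^ m))) hS,
      lintegral_hazardStep m ha hb (by positivity)]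
    · congr 1
      rw [Nat.factorial_succ]
      push_cast
      field_simp
      ring
    · rintro ⟨x, y⟩ hq
      simp only [ih hq.1.1 hq.2.1.1]
      congr 1
      field_simp

theorem tailSum_zero {m : ℕ} (θ : EuclideanSpace ℝ (Fin (m + 1))) : tailSum θ 0 = ∑ i, θ i := by
  simp only [tailSum]
  congr 1
  ext i
  simp

theorem tailSum_castSucc {m : ℕ} (θ : EuclideanSpace ℝ (Fin (m + 1))) (i : Fin m) :
    tailSum θ i.castSucc = θ i.castSucc + tailSum θ i.succ := by
  have : Finset.Ioi i.castSucc = Finset.Ici i.succ := by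
    ext k
    simp [Fin.castSucc_lt_iff_succ_le]
  rw [tailSum, tailSum, Finset.Ici_eq_cons_Ioi, Finset.sum_cons, this]

theorem tailSum_last {m : ℕ} (θ : EuclideanSpace ℝ (Fin (m + 1))) :
    tailSum θ (Fin.last m) = θ (Fin.last m) := by
  have : Finset.Ici (Fin.last m) = {Fin.last m} := by
    ext k
    simp [Fin.last_le_iff]
  simp [tailSum, this]

theorem tailSum_nonneg {n : ℕ} {θ : EuclideanSpace ℝ (Fin n)} (h : ∀ i, 0 ≤ θ i) (i : Fin n) :
    0 ≤ tailSum θ i :=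
  Finset.sum_nonneg fun k _ ↦ h k

/-- It is enough to check the hazard rate order on consecutive tail sums. -/
theorem hazardRateLE_iff_consecutive {m : ℕ} {θ θ' : EuclideanSpace ℝ (Fin (m + 1))}
    (h : ∀ i, 0 ≤ θ i) (h' : ∀ i, 0 ≤ θ' i) :
    HazardRateLE θ θ' ↔ ∀ i : Fin m,
      tailSum θ i.succ * tailSum θ' i.castSucc ≤ tailSum θ i.castSucc * tailSum θ' i.succ := by
  refine ⟨fun H i ↦ H _ _ (Fin.castSucc_lt_succ).le, fun H i j ↦ ?_⟩
  induction j using Fin.induction with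
  | zero =>
    intro hij
    rw [Fin.le_zero_iff.1 hij]
  | succ j ih =>
    intro hij
    rcases hij.eq_or_lt with rfl | hij
    · exact le_rfl
    have IH := ih (Fin.le_castSucc_iff.2 hij)
    have Hj := H j
    have e := tailSum_castSucc θ j
    have e' := tailSum_castSucc θ' j
    have n1 := h j.castSucc
    have n1' := h' j.castSucc
    have n2' := tailSum_nonneg h' j.succ
    have n3' := tailSum_nonneg h' i
    have n4' := tailSum_nonneg h' j.castSucc
    rcases n4'.eq_or_lt with z | pos
    · have z' : tailSum θ' j.succ = 0 := by linarith
      have hle : tailSum θ j.succ * tailSum θ' i ≤ tailSum θ j.castSucc * tailSum θ' i :=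
        mul_le_mul_of_nonneg_right (by linarith) n3'
      rw [← z, mul_zero] at IH
      rw [z', mul_zero]
      exact hle.trans IH
    · refine le_of_mul_le_mul_right ?_ pos
      calc tailSum θ j.succ * tailSum θ' i * tailSum θ' j.castSucc
          = (tailSum θ j.succ * tailSum θ' j.castSucc) * tailSum θ' i := by ring
        _ ≤ (tailSum θ j.castSucc * tailSum θ' j.succ) * tailSum θ' i :=
            mul_le_mul_of_nonneg_right Hj n3'
        _ = (tailSum θ j.castSucc * tailSum θ' i) * tailSum θ' j.succ := by ring
        _ ≤ (tailSum θ i * tailSum θ' j.castSucc) * tailSum θ' j.succ :=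
            mul_le_mul_of_nonneg_right IH n2'
        _ = tailSum θ i * tailSum θ' j.succ * tailSum θ' j.castSucc := by ring

theorem inducedDistribution_real_Ioi {n : ℕ} (x : Fin n → ℝ) {θ : EuclideanSpace ℝ (Fin n)}
    (h : ∀ i, 0 ≤ θ i) (s : ℝ) :
    (inducedDistribution x θ).real (Set.Ioi s) = ∑ i with s < x i, θ i := by
  rw [Measure.real, inducedDistribution, Measure.finsetSum_apply, ENNReal.toReal_sum,
    Finset.sum_filter]
  · refine Finset.sum_congr rfl fun i _ ↦ ?_
    by_cases hi : s < x i <;> simp [hi, h i]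
  · intro i _
    by_cases hi : s < x i <;> simp [hi]

theorem inducedDistribution_real_Ioi_eq_tailSum {n : ℕ} {x : Fin n → ℝ}
    {θ : EuclideanSpace ℝ (Fin n)} (h : ∀ i, 0 ≤ θ i) {s : ℝ} {i : Fin n}
    (hs : ∀ k, s < x k ↔ i ≤ k) :
    (inducedDistribution x θ).real (Set.Ioi s) = tailSum θ i := by
  rw [inducedDistribution_real_Ioi x h, tailSum]
  congr 1
  ext k
  simp [hs]

theorem exists_lt_iff_le_of_strictMono {n : ℕ} {x : Fin n → ℝ} (hx : StrictMono x) (i : Fin n) :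
    ∃ s, ∀ k, s < x k ↔ i ≤ k := by
  cases n with
  | zero => exact i.elim0
  | succ m =>
    induction i using Fin.cases with
    | zero =>
      refine ⟨x 0 - 1, fun k ↦ ?_⟩
      have := hx.monotone (Fin.zero_le k)
      simp only [Fin.zero_le, iff_true]
      linarith
    | succ i => exact ⟨x i.castSucc, fun k ↦ by rw [hx.lt_iff_lt, Fin.castSucc_lt_iff_succ_le]⟩

theorem exists_lt_iff_le_of_lt {n : ℕ} {x : Fin n → ℝ} (hx : StrictMono x) {s : ℝ} {j : Fin n}
    (hj : s < x j) : ∃ i, ∀ k, s < x k ↔ i ≤ k := by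
  have hne : (Finset.univ.filter fun k ↦ s < x k).Nonempty := ⟨j, by simpa using hj⟩
  refine ⟨Finset.min' _ hne, fun k ↦ ⟨fun hk ↦ Finset.min'_le _ _ (by simpa using hk), fun hk ↦ ?_⟩⟩
  have := Finset.min'_mem _ hne
  rw [Finset.mem_filter] at this
  exact this.2.trans_le (hx.monotone hk)

theorem measureHazardRateLE_iff {n : ℕ} {x : Fin n → ℝ} (hx : StrictMono x)
    {θ θ' : EuclideanSpace ℝ (Fin n)} (h : ∀ i, 0 ≤ θ i) (h' : ∀ i, 0 ≤ θ' i) :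
    MeasureHazardRateLE (inducedDistribution x θ) (inducedDistribution x θ') ↔
      HazardRateLE θ θ' := by
  constructor
  · intro H i j hij
    rcases hij.eq_or_lt with rfl | hij
    · exact le_rfl
    obtain ⟨s, hs⟩ := exists_lt_iff_le_of_strictMono hx i
    obtain ⟨t, ht⟩ := exists_lt_iff_le_of_strictMono hx j
    have hst : s ≤ t := ((hs i).2 le_rfl).le.trans (not_lt.1 fun hlt ↦ hij.not_ge ((ht i).1 hlt))
    have := H s t hst
    rwa [inducedDistribution_real_Ioi_eq_tailSum h hs,
      inducedDistribution_real_Ioi_eq_tailSum h ht, inducedDistribution_real_Ioi_eq_tailSum h' hs,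
      inducedDistribution_real_Ioi_eq_tailSum h' ht] at this
  · intro H s t hst
    by_cases hex : ∃ j, t < x j
    · obtain ⟨j₀, hj₀⟩ := hex
      obtain ⟨j, hj⟩ := exists_lt_iff_le_of_lt hx hj₀
      obtain ⟨i, hi⟩ := exists_lt_iff_le_of_lt hx (hst.trans_lt hj₀)
      rw [inducedDistribution_real_Ioi_eq_tailSum h hi,
        inducedDistribution_real_Ioi_eq_tailSum h hj,
        inducedDistribution_real_Ioi_eq_tailSum h' hi,
        inducedDistribution_real_Ioi_eq_tailSum h' hj]
      exact H i j ((hi j).1 (hst.trans_lt ((hj j).2 le_rfl)))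
    · have hempty : (Finset.univ.filter fun k ↦ t < x k) = ∅ := by
        simpa [Finset.filter_eq_empty_iff] using hex
      rw [inducedDistribution_real_Ioi x h t, inducedDistribution_real_Ioi x h' t, hempty]
      simp

/-- The tail sums of a vector, except for the first one. -/
noncomputable def properTailSums {m : ℕ} (θ : EuclideanSpace ℝ (Fin (m + 1))) : Fin m → ℝ :=
  fun i ↦ tailSum θ i.succ

theorem measurable_properTailSums {m : ℕ} : Measurable (properTailSums (m := m)) := by
  unfold properTailSums tailSum
  fun_prop

theorem tailSum_eq_cons {m : ℕ} (θ : EuclideanSpace ℝ (Fin (m + 1))) :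
    tailSum θ = Fin.cons (∑ i, θ i) (properTailSums θ) := by
  ext i
  induction i using Fin.cases with
  | zero => simp [tailSum_zero]
  | succ i => simp [properTailSums]

theorem mem_scaledSimplex_iff {m : ℕ} {u : ℝ} (hu : 0 ≤ u) {θ : EuclideanSpace ℝ (Fin (m + 1))} :
    θ ∈ scaledSimplex (m + 1) u ↔
      ∑ i, θ i = u ∧ properTailSums θ ∈ chainSet TailStep m u := by
  rw [scaledSimplex, Set.mem_ofPred_eq, and_comm]
  refine and_congr_right fun hsum ↦ ?_
  subst hsum
  rw [chainSet, Set.mem_ofPred_eq, ← tailSum_eq_cons]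
  refine ⟨fun h i ↦ ⟨tailSum_nonneg h _, ?_⟩, fun h ↦ ?_⟩
  · have := h i.castSucc
    rw [tailSum_castSucc, properTailSums]
    linarith
  · have hlast : 0 ≤ θ (Fin.last m) := by
      rw [← tailSum_last]
      cases m with
      | zero => rw [show Fin.last 0 = 0 from rfl, tailSum_zero]; exact hu
      | succ m => exact (h (Fin.last m)).1
    intro i
    induction i using Fin.lastCases with
    | last => exact hlast
    | cast i =>
      have := (h i).2
      rw [tailSum_castSucc, properTailSums] at this
      linarith

theorem measurableSet_scaledSimplex (n : ℕ) (u : ℝ) : MeasurableSet (scaledSimplex n u) := by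
  have : scaledSimplex n u = (⋂ i, {θ | 0 ≤ θ i}) ∩ {θ | ∑ i, θ i = u} := by
    ext
    simp [scaledSimplex]
  rw [this]
  exact (MeasurableSet.iInter fun i ↦ measurableSet_le measurable_const (by fun_prop)).inter
    (measurableSet_eq_fun (by fun_prop) measurable_const)

/-- The linear map that sends `t` to the vector with vanishing coordinate sum and proper tail
sums `t`. -/
noncomputable def ofTailSums (m : ℕ) :
    EuclideanSpace ℝ (Fin m) →ₗ[ℝ] EuclideanSpace ℝ (Fin (m + 1)) where
  toFun t := WithLp.toLp 2 fun i ↦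
    (Fin.cons 0 t.ofLp : Fin (m + 1) → ℝ) i - (Fin.snoc t.ofLp 0 : Fin (m + 1) → ℝ) i
  map_add' t t' := by
    ext i
    have h1 : (Fin.cons 0 (t + t').ofLp : Fin (m + 1) → ℝ) i =
        (Fin.cons 0 t.ofLp : Fin (m + 1) → ℝ) i + (Fin.cons 0 t'.ofLp : Fin (m + 1) → ℝ) i := by
      induction i using Fin.cases <;> simp
    have h2 : (Fin.snoc (t + t').ofLp 0 : Fin (m + 1) → ℝ) i =
        (Fin.snoc t.ofLp 0 : Fin (m + 1) → ℝ) i + (Fin.snoc t'.ofLp 0 : Fin (m + 1) → ℝ) i := by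
      induction i using Fin.lastCases <;> simp
    simp only [h1, h2, PiLp.add_apply]
    ring
  map_smul' c t := by
    ext i
    have h1 : (Fin.cons 0 (c • t).ofLp : Fin (m + 1) → ℝ) i =
        c * (Fin.cons 0 t.ofLp : Fin (m + 1) → ℝ) i := by
      induction i using Fin.cases <;> simp
    have h2 : (Fin.snoc (c • t).ofLp 0 : Fin (m + 1) → ℝ) i =
        c * (Fin.snoc t.ofLp 0 : Fin (m + 1) → ℝ) i := by
      induction i using Fin.lastCases <;> simp
    simp only [h1, h2, PiLp.smul_apply, smul_eq_mul, RingHom.id_apply]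
    ring

/-- A vector is determined by its coordinate sum and its proper tail sums. -/
theorem eq_of_sum_eq_of_properTailSums_eq {m : ℕ} {θ θ' : EuclideanSpace ℝ (Fin (m + 1))}
    (hsum : ∑ i, θ i = ∑ i, θ' i) (htail : properTailSums θ = properTailSums θ') : θ = θ' := by
  have h : tailSum θ = tailSum θ' := by rw [tailSum_eq_cons, tailSum_eq_cons, hsum, htail]
  ext i
  induction i using Fin.lastCases with
  | last => rw [← tailSum_last, ← tailSum_last, h]
  | cast i =>
    have h1 := tailSum_castSucc θ i
    have h2 := tailSum_castSucc θ' i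
    rw [h] at h1
    linarith

theorem tailSum_add {n : ℕ} (θ θ' : EuclideanSpace ℝ (Fin n)) :
    tailSum (θ + θ') = tailSum θ + tailSum θ' := by
  ext i
  simp [tailSum, Finset.sum_add_distrib]

theorem tailSum_ofTailSums {m : ℕ} (t : EuclideanSpace ℝ (Fin m)) :
    tailSum (ofTailSums m t) = Fin.cons 0 t.ofLp := by
  ext i
  induction i using Fin.reverseInduction with
  | last => simp [tailSum_last, ofTailSums]
  | cast i ih => rw [tailSum_castSucc, ih]; simp [ofTailSums]

theorem tailSum_single_zero {m : ℕ} (u : ℝ) :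
    tailSum (EuclideanSpace.single (0 : Fin (m + 1)) u) = Fin.cons u 0 := by
  ext i
  induction i using Fin.cases with
  | zero => simp [tailSum_zero]
  | succ i => simp [tailSum, Fin.succ_ne_zero]

theorem tailSum_ofTailSums_add_single {m : ℕ} (u : ℝ) (t : EuclideanSpace ℝ (Fin m)) :
    tailSum (ofTailSums m t + EuclideanSpace.single (0 : Fin (m + 1)) u) = Fin.cons u t.ofLp := by
  rw [tailSum_add, tailSum_ofTailSums, tailSum_single_zero]
  ext i
  induction i using Fin.cases <;> simp

/-- On a hyperplane of constant coordinate sum, the `m`-dimensional volume is proportional to the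
Lebesgue measure in the coordinates given by the proper tail sums. -/
theorem exists_euclideanHausdorffMeasure_eq_mul_volume (m : ℕ) (u : ℝ) :
    ∃ c : ℝ≥0∞, ∀ A : Set (Fin m → ℝ), MeasurableSet A →
      μHE[m] {θ : EuclideanSpace ℝ (Fin (m + 1)) | ∑ i, θ i = u ∧ properTailSums θ ∈ A} =
        c * volume A := by
  refine ⟨ENNReal.ofReal (ofTailSums m).normDet, fun A hA ↦ ?_⟩
  have himage : {θ : EuclideanSpace ℝ (Fin (m + 1)) | ∑ i, θ i = u ∧ properTailSums θ ∈ A} =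
      IsometryEquiv.addRight (EuclideanSpace.single (0 : Fin (m + 1)) u) ''
        (ofTailSums m '' (WithLp.ofLp ⁻¹' A)) := by
    ext θ
    rw [Set.image_image, Set.mem_image]
    constructor
    · rintro ⟨hsum, htail⟩
      have h := tailSum_ofTailSums_add_single u (WithLp.toLp 2 (properTailSums θ))
      rw [tailSum_eq_cons, Fin.cons_inj] at h
      exact ⟨WithLp.toLp 2 (properTailSums θ), htail,
        eq_of_sum_eq_of_properTailSums_eq (h.1.trans hsum.symm) h.2⟩
    · rintro ⟨t, ht, rfl⟩
      have h := tailSum_ofTailSums_add_single u t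
      rw [tailSum_eq_cons, Fin.cons_inj] at h
      refine ⟨h.1, ?_⟩
      change properTailSums (ofTailSums m t + EuclideanSpace.single 0 u) ∈ A
      rw [h.2]
      exact ht
  have hvol := (ofTailSums m).euclideanHausdorffMeasure_image_eq_normDet_mul_volume
    (WithLp.ofLp ⁻¹' A)
  rw [finrank_euclideanSpace_fin] at hvol
  rw [himage, (IsometryEquiv.isometry _).euclideanHausdorffMeasure_image, hvol]
  congr 1
  exact (EuclideanSpace.volume_preserving_symm_measurableEquiv_toLp (Fin m)).measure_preimage
    hA.nullMeasurableSet

theorem measurableSet_chainSet_left {X : Type*} [MeasurableSpace X] {R : X → X → Prop}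
    (hR : MeasurableSet {p : X × X | R p.1 p.2}) (m : ℕ) (a : X) :
    MeasurableSet (chainSet R m a) :=
  (measurable_const.prodMk measurable_id : Measurable fun t : Fin m → X ↦ (a, t))
    (measurableSet_chainSet hR m)

section Uniform

variable {Ω : Type*} [MeasurableSpace Ω] {P : Measure Ω} {m : ℕ} {u : ℝ}
  {Θ : Ω → EuclideanSpace ℝ (Fin (m + 1))}

theorem IsUniformOnSimplex.measure_ne_zero_and_ne_top [IsProbabilityMeasure P]
    (hΘ : Measurable Θ) (h : IsUniformOnSimplex P u Θ) :
    (μHE[m] : Measure (EuclideanSpace ℝ (Fin (m + 1)))) (scaledSimplex (m + 1) u) ≠ 0 ∧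
      (μHE[m] : Measure (EuclideanSpace ℝ (Fin (m + 1)))) (scaledSimplex (m + 1) u) ≠ ∞ := by
  have hone : P.map Θ Set.univ = 1 := by
    rw [Measure.map_apply hΘ MeasurableSet.univ, Set.preimage_univ, measure_univ]
  have h' : P.map Θ = cond μHE[m] (scaledSimplex (m + 1) u) := h
  constructor <;> intro h0 <;> rw [h', ProbabilityTheory.cond] at hone <;> simp [h0] at hone

theorem IsUniformOnSimplex.ae_mem (hΘ : Measurable Θ) (h : IsUniformOnSimplex P u Θ) :
    ∀ᵐ ω ∂P, Θ ω ∈ scaledSimplex (m + 1) u := by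
  have h' : P.map Θ = cond μHE[m] (scaledSimplex (m + 1) u) := h
  refine ae_of_ae_map hΘ.aemeasurable (p := (· ∈ scaledSimplex (m + 1) u)) ?_
  rw [h']
  exact ae_cond_mem (measurableSet_scaledSimplex _ _)

/-- The proper tail sums of a uniform vector on the simplex are uniform on the chains that start
at `u`. -/
theorem IsUniformOnSimplex.map_properTailSums [IsProbabilityMeasure P] (hu : 0 ≤ u)
    (hΘ : Measurable Θ) (h : IsUniformOnSimplex P u Θ) :
    P.map (fun ω ↦ properTailSums (Θ ω)) = cond volume (chainSet TailStep m u) := by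
  obtain ⟨c, hc⟩ := exists_euclideanHausdorffMeasure_eq_mul_volume m u
  obtain ⟨h0, htop⟩ := h.measure_ne_zero_and_ne_top hΘ
  have hC := measurableSet_chainSet_left measurableSet_tailStep m u
  have hS : scaledSimplex (m + 1) u = {θ : EuclideanSpace ℝ (Fin (m + 1)) |
      ∑ i, θ i = u ∧ properTailSums θ ∈ chainSet TailStep m u} :=
    Set.ext fun θ ↦ mem_scaledSimplex_iff hu
  have hvol := hc _ hC
  rw [← hS] at hvol
  rw [hvol] at h0 htop
  have hc0 : c ≠ 0 := left_ne_zero_of_mul h0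
  have hctop : c ≠ ∞ := by
    rintro rfl
    exact htop (ENNReal.top_mul (right_ne_zero_of_mul h0))
  have h' : P.map Θ = cond μHE[m] (scaledSimplex (m + 1) u) := h
  ext A hA
  change P.map (properTailSums ∘ Θ) A = _
  rw [← Measure.map_map measurable_properTailSums hΘ, h',
    Measure.map_apply measurable_properTailSums hA, cond_apply (measurableSet_scaledSimplex _ _),
    cond_apply hC, hvol]
  have hinter : scaledSimplex (m + 1) u ∩ properTailSums ⁻¹' A =
      {θ : EuclideanSpace ℝ (Fin (m + 1)) |
        ∑ i, θ i = u ∧ properTailSums θ ∈ chainSet TailStep m u ∩ A} := by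
    rw [hS]
    ext θ
    simp [and_assoc]
  rw [hinter, hc _ (hC.inter hA), ENNReal.mul_inv (.inl hc0) (.inl hctop),
    mul_mul_mul_comm, ENNReal.inv_mul_cancel hc0 hctop, one_mul]

end Uniform

theorem cons_prodMk {X Y : Type*} {m : ℕ} (a : X) (b : Y) (s : Fin m → X) (t : Fin m → Y)
    (i : Fin (m + 1)) :
    (Fin.cons (a, b) (fun i ↦ (s i, t i)) : Fin (m + 1) → X × Y) i =
      ((Fin.cons a s : Fin (m + 1) → X) i, (Fin.cons b t : Fin (m + 1) → Y) i) := by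
  induction i using Fin.cases <;> simp

theorem mem_chainSet_hazardStep_iff {m : ℕ} {a b : ℝ} {s t : Fin m → ℝ} :
    (fun i ↦ (s i, t i)) ∈ chainSet HazardStep m (a, b) ↔
      s ∈ chainSet TailStep m a ∧ t ∈ chainSet TailStep m b ∧
        ∀ i : Fin m, s i * (Fin.cons b t : Fin (m + 1) → ℝ) i.castSucc ≤
          (Fin.cons a s : Fin (m + 1) → ℝ) i.castSucc * t i := by
  simp only [chainSet, HazardStep, Set.mem_ofPred_eq, cons_prodMk, forall_and]

theorem hazardRateLE_iff_mem_chainSet {m : ℕ} {u : ℝ} (hu : 0 ≤ u)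
    {θ θ' : EuclideanSpace ℝ (Fin (m + 1))} (h : θ ∈ scaledSimplex (m + 1) u)
    (h' : θ' ∈ scaledSimplex (m + 1) u) :
    HazardRateLE θ θ' ↔
      (fun i ↦ (properTailSums θ i, properTailSums θ' i)) ∈ chainSet HazardStep m (u, u) := by
  obtain ⟨hs, hC⟩ := (mem_scaledSimplex_iff hu).1 h
  obtain ⟨hs', hC'⟩ := (mem_scaledSimplex_iff hu).1 h'
  have e := tailSum_eq_cons θ
  have e' := tailSum_eq_cons θ'
  rw [hs] at e
  rw [hs'] at e'
  rw [hazardRateLE_iff_consecutive h.1 h'.1, mem_chainSet_hazardStep_iff, ← e, ← e']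
  simp only [hC, hC', true_and, properTailSums]

/-- Two independent uniform chains are hazard rate ordered with probability `2⁻ᵐ`. -/
theorem cond_prod_cond_chainSet_hazardStep (m : ℕ) {u : ℝ} (hu : 0 < u) :
    ((cond volume (chainSet TailStep m u)).prod (cond volume (chainSet TailStep m u)))
      {p : (Fin m → ℝ) × (Fin m → ℝ) | (fun i ↦ (p.1 i, p.2 i)) ∈ chainSet HazardStep m (u, u)} =
      1 / 2 ^ m := by
  set D := {p : (Fin m → ℝ) × (Fin m → ℝ) |
    (fun i ↦ (p.1 i, p.2 i)) ∈ chainSet HazardStep m (u, u)}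
  have hvolD : (volume : Measure ((Fin m → ℝ) × (Fin m → ℝ))) D =
      volume (chainSet HazardStep m (u, u)) :=
    (volume_measurePreserving_arrowProdEquivProdArrow ℝ ℝ (Fin m)).symm.measure_preimage
      (measurableSet_chainSet_left measurableSet_hazardStep m (u, u)).nullMeasurableSet
  have hsub : D ⊆ chainSet TailStep m u ×ˢ chainSet TailStep m u := fun p hp ↦
    ⟨(mem_chainSet_hazardStep_iff.1 hp).1, (mem_chainSet_hazardStep_iff.1 hp).2.1⟩
  have hr : 0 < u ^ m / m.factorial := by positivity
  rw [ProbabilityTheory.cond, Measure.prod_smul_left, Measure.prod_smul_right,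
    Measure.prod_restrict, ← Measure.volume_eq_prod, Measure.smul_apply, Measure.smul_apply,
    Measure.restrict_eq_self _ hsub, hvolD, volume_chainSet_tailStep m hu.le,
    volume_chainSet_hazardStep m hu.le hu.le, smul_eq_mul, smul_eq_mul,
    ← ENNReal.ofReal_inv_of_pos hr, ← ENNReal.ofReal_mul (by positivity),
    ← ENNReal.ofReal_mul (by positivity)]
  rw [show (u ^ m / m.factorial)⁻¹ * ((u ^ m / m.factorial)⁻¹ *
      (u ^ m / m.factorial * (u ^ m / m.factorial) / 2 ^ m)) = ((2 : ℝ) ^ m)⁻¹ by field_simp,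
    ENNReal.ofReal_inv_of_pos (by positivity), ENNReal.ofReal_pow (by norm_num), one_div]
  simp

theorem mainTheorem1 {Ω : Type*} [MeasurableSpace Ω] (P : Measure Ω) [IsProbabilityMeasure P]
    (n : ℕ) (hn : 1 ≤ n) (u : ℝ) (hu : 0 < u)
    (Θ Θ' : Ω → EuclideanSpace ℝ (Fin n)) (hΘ : Measurable Θ) (hΘ' : Measurable Θ')
    (hunif : IsUniformOnSimplex P u Θ) (hunif' : IsUniformOnSimplex P u Θ')
    (hindep : IndepFun Θ Θ' P) :
    P {ω | HazardRateLE (Θ ω) (Θ' ω)} = 1 / 2 ^ (n - 1) ∧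
    ∀ x : Fin n → ℝ, StrictMono x →
      P {ω | MeasureHazardRateLE (inducedDistribution x (Θ ω)) (inducedDistribution x (Θ' ω))}
        = 1 / 2 ^ (n - 1) := by
  obtain ⟨m, rfl⟩ : ∃ m, n = m + 1 := ⟨n - 1, by omega⟩
  have hmem := hunif.ae_mem hΘ
  have hmem' := hunif'.ae_mem hΘ'
  have hfirst : P {ω | HazardRateLE (Θ ω) (Θ' ω)} = 1 / 2 ^ (m + 1 - 1) := by
    have hS := measurable_properTailSums.comp hΘ
    have hS' := measurable_properTailSums.comp hΘ'
    have hlaw := (indepFun_iff_map_prod_eq_prod_map_map hS.aemeasurable hS'.aemeasurable).1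
      (hindep.comp measurable_properTailSums measurable_properTailSums)
    have hmeas : MeasurableSet {p : (Fin m → ℝ) × (Fin m → ℝ) |
        (fun i ↦ (p.1 i, p.2 i)) ∈ chainSet HazardStep m (u, u)} :=
      (MeasurableEquiv.arrowProdEquivProdArrow ℝ ℝ (Fin m)).symm.measurable
        (measurableSet_chainSet_left measurableSet_hazardStep m (u, u))
    rw [Nat.add_sub_cancel, ← cond_prod_cond_chainSet_hazardStep m hu]
    nth_rw 1 [← hunif.map_properTailSums hu.le hΘ]
    rw [← hunif'.map_properTailSums hu.le hΘ']
    change _ = ((P.map (properTailSums ∘ Θ)).prod (P.map (properTailSums ∘ Θ'))) _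
    rw [← hlaw, Measure.map_apply (hS.prodMk hS') hmeas]
    refine measure_congr ?_
    filter_upwards [hmem, hmem'] with ω h h'
    exact propext (hazardRateLE_iff_mem_chainSet hu.le h h')
  refine ⟨hfirst, fun x hx ↦ ?_⟩
  rw [← hfirst]
  refine measure_congr ?_
  filter_upwards [hmem, hmem'] with ω h h'
  exact propext (measureHazardRateLE_iff hx h.1 h'.1)
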